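/- Let $E/F$ be a separable quadratic extension of global fields (number fields, or function fields in one variable over a finite field), let $\alpha$ be the nontrivial element of ${\rm Gal}(E/F)$, and let $\mathbb{A}_E=\prod_w{}'(E_w:\mathcal{O}_w)$ be the adele ring of $E$, the restricted product of the completions of $E$ over all places $w$ of $E$. Endow $\mathbb{A}_E$ with the involution $*$ induced by $\alpha$: for each place $w$, $\alpha$ extends continuously to an isomorphism $E_w\to E_{\alpha w}$, and $(x^*)_{\alpha w}=\alpha(x_w)$. Thus, if there is only one place $w$ of $E$ above a place $v$ of $F$, then $*$ acts on $E_w$ as the extension of $\alpha$, while if $v$ splits, it is the flip on $\prod_{w\mid v}E_w\simeq F_v\times F_v$. For $n\ge 1$, endow $A={\rm M}(n,\mathbb{A}_E)$ with the involution $(a_{ij})^*=(a_{ji}^*)$, and write $A^{\rm sym}=\{s\in A: s^*=s\}$. For $a,c\in A$ with $Aa+Ac=A$ and $a^*c\in A^{\rm sym}$, say that $(a,c)$ has a decomposition of length $m\ge 0$ if, setting $r_{-1}=a$ and $r_0=c$, there exist $s_0,\dots,s_{m-1}\in A^{\rm sym}$ and $r_1,\dots,r_m\in A$ such that $r_{i-1}=s_ir_i+r_{i+1}$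 for $0\le i<m$ and $r_m\in A^\times$. Then $A$ is $*$-Euclidean, that is, every such pair $(a,c)$ has a decomposition of some length, and its decomposition length is $1$: the least $m$ such that every such pair has a decomposition of length $m$ is $m=1$. In particular, for every such pair there is $s\in A^{\rm sym}$ with $a-sc\in A^\times$. -/

import Mathlib

open scoped RestrictedProduct

noncomputable section

/-! ### `*`-Euclidean rings -/

section StarEuclidean

variable {A : Type*} [Ring A] [StarRing A]

/-- The pairs `(a, c)` to which the `*`-Euclidean algorithm is applied: `Aa + Ac = A` (a sum of
left ideals) and `a^* c` is symmetric. -/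
def IsStarCoprime (a c : A) : Prop :=
  Ideal.span {a} ⊔ Ideal.span {c} = (⊤ : Ideal A) ∧ IsSelfAdjoint (star a * c)

/-- `(a, c)` has a decomposition of length `n`: with `r_{-1} = a` and `r_0 = c` there are
symmetric `s_0, …, s_{n-1}`, elements `r_1, …, r_{n-1}` and a unit `r_n` such that
`r_{i-1} = s_i r_i + r_{i+1}` for `0 ≤ i < n`. The index of `r` is shifted by one:
`r k` stands for `r_{k-1}`. -/
def HasStarDecomposition (a c : A) (n : ℕ) : Prop :=
  ∃ r s : ℕ → A, r 0 = a ∧ r 1 = c ∧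
    (∀ i < n, IsSelfAdjoint (s i) ∧ r i = s i * r (i + 1) + r (i + 2)) ∧ IsUnit (r (n + 1))

variable (A)

/-- `A` is `*`-Euclidean. -/
def IsStarEuclidean : Prop :=
  ∀ a c : A, IsStarCoprime a c → ∃ n : ℕ, HasStarDecomposition a c n

/-- `ℓ` is the (decomposition) length of `A`: the least length that is valid for all pairs. -/
def IsStarEuclideanLength (ℓ : ℕ) : Prop :=
  IsLeast {n : ℕ | ∀ a c : A, IsStarCoprime a c → HasStarDecomposition a c n} ℓ

end StarEuclidean

/-! ### Global fields and their adele rings -/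

namespace GlobalField

/-- A global field: a number field, or a finite extension of `𝔽_p(X)` for some prime `p`
(equivalently, a function field in one variable over some finite field). -/
def IsGlobalField (K : Type*) [Field K] : Prop :=
  NumberField K ∨ ∃ (p : ℕ) (_ : Fact p.Prime) (_ : Algebra (RatFunc (ZMod p)) K),
    FunctionField (ZMod p) K

/-- The finite (that is, non-archimedean) places of a global field `K`, each given by its valuation
ring in `K`: the valuation rings of `K` other than `K` itself. For a number field these are the
localizations of the ring of integers at its nonzero primes; for a function field they are all
the places, including those "at infinity". The infinite (archimedean) places are Mathlib's
`NumberField.InfinitePlace K`; there are none in positive characteristic. -/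
def FinitePlace (K : Type*) [Field K] : Type _ := {v : ValuationSubring K // v ≠ ⊤}

section Adele

variable (K : Type*) [Field K]

/-- The completion `K_v` at a finite place. -/
abbrev FinitePlace.Completion {K : Type*} [Field K] (v : FinitePlace K) : Type _ :=
  v.1.valuation.Completion

/-- The ring of integers `𝒪_v` of `K_v`. -/
def FinitePlace.integers {K : Type*} [Field K] (v : FinitePlace K) :
    ValuationSubring v.Completion :=
  (Valued.v : Valuation v.Completion v.1.ValueGroup).valuationSubring

/-- The finite adeles: the restricted product of the `K_v` with respect to the `𝒪_v`, over all
finite places. -/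
abbrev FiniteAdeleRing : Type _ :=
  Πʳ v : FinitePlace K, [v.Completion, v.integers]

/-- The adele ring `𝔸_K`. -/
abbrev AdeleRing : Type _ :=
  NumberField.InfiniteAdeleRing K × FiniteAdeleRing K

end Adele

/-! ### The action of a field automorphism on the adeles -/

section Action

variable {K : Type*} [Field K]

open NumberField

/-- If `σ` carries the infinite place `w` to the infinite place `w'`, this is the continuous
extension `K_w → K_{w'}` of `σ`. -/
def infiniteMap (σ : K ≃+* K) (w w' : InfinitePlace K) (h : ∀ x, w' (σ x) = w x) :
    w.Completion →+* w'.Completion :=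
  (InfinitePlace.Completion.equiv w').symm.toRingHom.comp
    ((Isometry.mapRingHom (f := ((WithAbs.equiv w'.1).symm.toRingHom.comp
        (σ.toRingHom.comp (WithAbs.equiv w.1).toRingHom)))
      (AddMonoidHomClass.isometry_of_norm _ fun x ↦ h x.ofAbs)).comp
      (InfinitePlace.Completion.equiv w).toRingHom)

theorem infiniteMap_coe (σ : K ≃+* K) (w w' : InfinitePlace K) (h : ∀ x, w' (σ x) = w x) (x : K) :
    infiniteMap σ w w' h (x : w.Completion) = ((σ x : K) : w'.Completion) := by
  apply InfinitePlace.Completion.ext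
  exact Isometry.mapRingHom_coe (AddMonoidHomClass.isometry_of_norm
    ((WithAbs.equiv w'.1).symm.toRingHom.comp (σ.toRingHom.comp (WithAbs.equiv w.1).toRingHom))
    fun x ↦ h x.ofAbs) (WithAbs.toAbs w.1 x)

theorem continuous_infiniteMap (σ : K ≃+* K) (w w' : InfinitePlace K) (h : ∀ x, w' (σ x) = w x) :
    Continuous (infiniteMap σ w w' h) :=
  (InfinitePlace.Completion.continuous_ofCompletion w').comp
    (UniformSpace.Completion.continuous_map.comp
      (InfinitePlace.Completion.continuous_toCompletion w))

theorem infiniteMap_infiniteMap (σ : K ≃+* K) (hσ : ∀ x, σ (σ x) = x) (w w' : InfinitePlace K)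
    (h : ∀ x, w' (σ x) = w x) (h' : ∀ x, w (σ x) = w' x) (x : w.Completion) :
    infiniteMap σ w' w h' (infiniteMap σ w w' h x) = x := by
  induction x using InfinitePlace.Completion.induction_on with
  | hp =>
    exact isClosed_eq
      ((continuous_infiniteMap σ w' w h').comp (continuous_infiniteMap σ w w' h)) continuous_id
  | ih a =>
    have := infiniteMap_coe σ w w' h a.ofAbs
    have h2 := infiniteMap_coe σ w' w h' (σ a.ofAbs)
    rw [hσ] at h2
    exact (congrArg _ this).trans h2

theorem valuation_le_iff (σ : K ≃+* K) (w w' : FinitePlace K)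
    (h : ∀ x, σ x ∈ w'.1 ↔ x ∈ w.1) (x y : K) :
    w'.1.valuation (σ x) ≤ w'.1.valuation (σ y) ↔ w.1.valuation x ≤ w.1.valuation y := by
  by_cases hy : y = 0
  · simp [hy]
  · have hy' : σ y ≠ 0 := by simpa using hy
    rw [← div_le_one₀ (by simpa [zero_lt_iff] using hy'), ← map_div₀, ← map_div₀,
      ValuationSubring.valuation_le_one_iff, h, ← ValuationSubring.valuation_le_one_iff,
      map_div₀, div_le_one₀ (by simpa [zero_lt_iff] using hy)]

theorem valuation_lt_iff (σ : K ≃+* K) (w w' : FinitePlace K)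
    (h : ∀ x, σ x ∈ w'.1 ↔ x ∈ w.1) (x y : K) :
    w'.1.valuation (σ x) < w'.1.valuation (σ y) ↔ w.1.valuation x < w.1.valuation y := by
  simpa using not_congr (valuation_le_iff σ w w' h y x)

theorem continuous_withValMap (σ : K ≃+* K) (w w' : FinitePlace K)
    (h : ∀ x, σ x ∈ w'.1 ↔ x ∈ w.1) :
    Continuous (WithVal.map w.1.valuation w'.1.valuation σ.toRingHom) := by
  refine continuous_of_continuousAt_zero _ ?_
  simp_rw [ContinuousAt, map_zero, (Valued.hasBasis_nhds_zero _ _).tendsto_iff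
    (Valued.hasBasis_nhds_zero _ _), true_and, forall_const]
  intro γ
  obtain ⟨r, s, hr, hs, hγ⟩ :=
    (Valued.v (R := WithVal w'.1.valuation)).exists_div_eq_of_unit γ
  rw [← map_div₀] at hγ
  generalize ht : r / s = t at hγ
  have ht0 : t ≠ 0 := by
    rintro rfl
    exact γ.ne_zero (by rw [← hγ, map_zero])
  let u : WithVal w.1.valuation := WithVal.toVal _ (σ.symm t.ofVal)
  have hu0 : u ≠ 0 := by
    intro h0
    apply ht0
    have : σ.symm t.ofVal = 0 := congrArg WithVal.ofVal h0
    simpa using this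
  refine ⟨Units.mk0 ((Valued.v (R := WithVal w.1.valuation)).restrict u)
    ((map_ne_zero _).2 hu0), fun x hx ↦ ?_⟩
  simp only [Set.mem_ofPred_eq, Units.val_mk0, Valuation.restrict_lt_iff] at hx
  simp only [Set.mem_ofPred_eq, ← hγ, Valuation.restrict_lt_iff]
  have := (valuation_lt_iff σ w w' h x.ofVal (σ.symm t.ofVal)).2 hx
  rw [σ.apply_symm_apply] at this
  exact this

/-- If `σ` carries the finite place `w` to the finite place `w'`, this is the continuous
extension `K_w → K_{w'}` of `σ`. -/
def finiteMap (σ : K ≃+* K) (w w' : FinitePlace K) (h : ∀ x, σ x ∈ w'.1 ↔ x ∈ w.1) :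
    w.Completion →+* w'.Completion :=
  UniformSpace.Completion.mapRingHom (WithVal.map w.1.valuation w'.1.valuation σ.toRingHom)
    (continuous_withValMap σ w w' h)

theorem finiteMap_coe (σ : K ≃+* K) (w w' : FinitePlace K) (h : ∀ x, σ x ∈ w'.1 ↔ x ∈ w.1)
    (x : K) : finiteMap σ w w' h (x : w.Completion) = ((σ x : K) : w'.Completion) :=
  UniformSpace.Completion.mapRingHom_coe (continuous_withValMap σ w w' h) _

theorem continuous_finiteMap (σ : K ≃+* K) (w w' : FinitePlace K)
    (h : ∀ x, σ x ∈ w'.1 ↔ x ∈ w.1) : Continuous (finiteMap σ w w' h) :=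
  UniformSpace.Completion.continuous_map

theorem finiteMap_finiteMap (σ : K ≃+* K) (hσ : ∀ x, σ (σ x) = x) (w w' : FinitePlace K)
    (h : ∀ x, σ x ∈ w'.1 ↔ x ∈ w.1) (h' : ∀ x, σ x ∈ w.1 ↔ x ∈ w'.1) (x : w.Completion) :
    finiteMap σ w' w h' (finiteMap σ w w' h x) = x := by
  induction x using UniformSpace.Completion.induction_on with
  | hp =>
    exact isClosed_eq
      ((continuous_finiteMap σ w' w h').comp (continuous_finiteMap σ w w' h)) continuous_id
  | ih a =>
    have h1 := finiteMap_coe σ w w' h a.ofVal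
    have h2 := finiteMap_coe σ w' w h' (σ a.ofVal)
    rw [hσ] at h2
    exact (congrArg _ h1).trans h2

theorem finiteMap_mem_integers (σ : K ≃+* K) (w w' : FinitePlace K)
    (h : ∀ x, σ x ∈ w'.1 ↔ x ∈ w.1) (x : w.Completion) (hx : x ∈ w.integers) :
    finiteMap σ w w' h x ∈ w'.integers := by
  have key : x ∉ w.integers ∨ finiteMap σ w w' h x ∈ w'.integers := by
    clear hx
    induction x using UniformSpace.Completion.induction_on with
    | hp =>
      exact IsClosed.union (Valued.isOpen_valuationSubring _).isClosed_compl
        ((Valued.isClosed_valuationSubring _).preimage (continuous_finiteMap σ w w' h))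
    | ih a =>
      by_cases ha : a.ofVal ∈ w.1
      · right
        have h1 : w'.1.valuation (σ a.ofVal) ≤ 1 :=
          (ValuationSubring.valuation_le_one_iff _ _).2 ((h _).2 ha)
        rw [show finiteMap σ w w' h a = _ from finiteMap_coe σ w w' h a.ofVal]
        exact (Valued.valuedCompletion_apply
          (WithVal.toVal w'.1.valuation (σ a.ofVal))).trans_le h1
      · left
        intro h1
        apply ha
        rw [← ValuationSubring.valuation_le_one_iff]
        exact (Valued.valuedCompletion_apply a).symm.trans_le h1
  exact key.resolve_left (not_not.2 hx)

/-- The finite place `σ⁻¹ w` whose valuation ring is the preimage of that of `w` under `σ`. -/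
def FinitePlace.comap (σ : K ≃+* K) (w : FinitePlace K) : FinitePlace K :=
  ⟨w.1.comap σ.toRingHom, fun h ↦ w.2 <| by
    rw [eq_top_iff]
    intro x _
    have hx : σ.symm x ∈ w.1.comap σ.toRingHom := by rw [h]; exact ValuationSubring.mem_top _
    have hx' : σ (σ.symm x) ∈ w.1 := hx
    rwa [σ.apply_symm_apply] at hx'⟩

theorem FinitePlace.comap_injective (σ : K ≃+* K) :
    Function.Injective (FinitePlace.comap σ) := by
  intro w w' h
  apply Subtype.ext
  ext x
  have := congrArg (fun v : FinitePlace K ↦ σ.symm x ∈ v.1) h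
  simpa [FinitePlace.comap, ValuationSubring.mem_comap] using this

/-- The action of a field automorphism `σ` on the adeles: it carries the component at `σ⁻¹ w`
to the component at `w` by the continuous extension of `σ`. -/
def adeleMap (σ : K ≃+* K) : AdeleRing K →+* AdeleRing K :=
  RingHom.prodMap
    (RingHom.pi fun w : InfinitePlace K ↦
      (infiniteMap σ (w.comap (σ : K →+* K)) w fun _ ↦ rfl).comp (Pi.evalRingHom _ _))
    (RestrictedProduct.mapAlongRingHom _ _ (FinitePlace.comap σ)
      (FinitePlace.comap_injective σ).tendsto_cofinite
      (fun w ↦ finiteMap σ (w.comap σ) w fun _ ↦ Iff.rfl)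
      (Filter.Eventually.of_forall fun w x hx ↦ finiteMap_mem_integers σ _ w _ x hx))

theorem adeleMap_fst (σ : K ≃+* K) (x : AdeleRing K) (w : InfinitePlace K) :
    (adeleMap σ x).1 w = infiniteMap σ (w.comap (σ : K →+* K)) w (fun _ ↦ rfl) (x.1 _) := rfl

theorem adeleMap_snd (σ : K ≃+* K) (x : AdeleRing K) (w : FinitePlace K) :
    (adeleMap σ x).2 w = finiteMap σ (w.comap σ) w (fun _ ↦ Iff.rfl) (x.2 (w.comap σ)) := rfl

theorem adeleMap_adeleMap (σ : K ≃+* K) (hσ : ∀ x, σ (σ x) = x) (x : AdeleRing K) :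
    adeleMap σ (adeleMap σ x) = x := by
  refine Prod.ext ?_ ?_
  · funext w
    have aux : ∀ (w₁ w₂ : InfinitePlace K) (h₁ : ∀ x, w (σ x) = w₁ x)
        (h₂ : ∀ x, w₁ (σ x) = w₂ x), w₂ = w →
        infiniteMap σ w₁ w h₁ (infiniteMap σ w₂ w₁ h₂ (x.1 w₂)) = x.1 w := by
      rintro w₁ w₂ h₁ h₂ rfl
      exact infiniteMap_infiniteMap σ hσ _ _ _ _ _
    refine aux _ _ (fun _ ↦ rfl) (fun _ ↦ rfl) ?_
    ext y
    simp [hσ]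
  · ext w
    have aux : ∀ (w₁ w₂ : FinitePlace K) (h₁ : ∀ x, σ x ∈ w.1 ↔ x ∈ w₁.1)
        (h₂ : ∀ x, σ x ∈ w₁.1 ↔ x ∈ w₂.1), w₂ = w →
        finiteMap σ w₁ w h₁ (finiteMap σ w₂ w₁ h₂ (x.2 w₂)) = x.2 w := by
      rintro w₁ w₂ h₁ h₂ rfl
      exact finiteMap_finiteMap σ hσ _ _ _ _ _
    refine aux _ _ (fun _ ↦ Iff.rfl) (fun _ ↦ Iff.rfl) ?_
    apply Subtype.ext
    ext y
    simp [FinitePlace.comap, ValuationSubring.mem_comap, hσ]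

end Action

/-! ### The involution attached to a separable quadratic extension -/

section Quadratic

variable {F E : Type*} [Field F] [Field E] [Algebra F E]

theorem quadratic_involutive [Algebra.IsQuadraticExtension F E] [Algebra.IsSeparable F E]
    (α : E ≃ₐ[F] E) (x : E) : α (α x) = x := by
  have hc : Nat.card (E ≃ₐ[F] E) = 2 := by
    rw [IsGalois.card_aut_eq_finrank, Algebra.IsQuadraticExtension.finrank_eq_two]
  have h2 : α ^ 2 = 1 := hc ▸ pow_card_eq_one'
  have := congrArg (fun β : E ≃ₐ[F] E ↦ β x) h2
  simpa [pow_two] using this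

/-- The involution of `𝔸_E` induced by an element `α` of the Galois group of a separable quadratic
extension `E/F`. Over a place `v` of `F` with a single place `w` of `E` above it, it is the
continuous extension of `α` to `E_w`; over a place with two places `w ≠ w'` above it,
it exchanges `E_w` and `E_{w'}` (both of them `F_v`) through the extension of `α`. -/
@[reducible]
def adeleStarRing [Algebra.IsQuadraticExtension F E] [Algebra.IsSeparable F E]
    (α : E ≃ₐ[F] E) : StarRing (AdeleRing E) where
  star := adeleMap α.toRingEquiv
  star_involutive := adeleMap_adeleMap _ (quadratic_involutive α)
  star_mul x y := by
    rw [map_mul, mul_comm]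
  star_add := map_add _

end Quadratic

end GlobalField

end

/-! The problem is solved on each orbit of the involution on the places and then glued. On an orbit
the coefficient ring is a local ring with involution (a completion or its valuation ring), or a
product of two local rings exchanged by the involution.

There one inducts on the size of the matrices. If `c` has no unit entry, then `u * a + v * c = 1`
makes `a` invertible modulo the maximal ideal, and `s = 0` works. Otherwise a unit entry is moved to
the diagonal and its row and column are cleared, turning `c` into `diag(1, c₄)`. Symmetry then ties
the off-diagonal blocks of `a` together so that `(a₄, c₄)` is again an admissible pair
(`of_blocks`). In the exchanged case, if one component of `c` has no unit entry, symmetry makes both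
components of `a` invertible (`exists_shift_of_flip`).

The data `a, c, u, v` are integral at almost all places. On orbits where they are, the argument is
run over the valuation rings, so both the shift and the inverse it produces are integral and the
local solutions form adelic matrices. Length `0` is excluded by the pair `(1, 0)`. -/

open scoped RestrictedProduct
open Matrix

/-! ### Elimination for Hermitian pairs over a commutative ring with involution -/

section StarPair

variable {S : Type*} [CommRing S] [StarRing S]
variable {ι κ : Type*} [Fintype ι] [DecidableEq ι] [Fintype κ] [DecidableEq κ]

/-- A coprime pair of square matrices with `aᴴ * c` Hermitian. -/
def IsHermitianPair (a c : Matrix ι ι S) : Prop :=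
  (∃ u v : Matrix ι ι S, u * a + v * c = 1) ∧ (aᴴ * c)ᴴ = aᴴ * c

/-- Subtracting a Hermitian multiple of `c` from `a` can yield a unit. -/
def HasHermitianShift (a c : Matrix ι ι S) : Prop :=
  ∃ s : Matrix ι ι S, sᴴ = s ∧ IsUnit (a - s * c)

/-- With `p' = p⁻¹`, the factors `pᴴ` and `p'ᴴ` cancel in the product, so `aᴴ * c` only changes by
the congruence with `q`. This allows `c` to be multiplied by arbitrary invertible matrices on both
sides. -/
theorem IsHermitianPair.transform {a c p p' q : Matrix ι ι S} (h : IsHermitianPair a c)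
    (hp : p' * p = 1) (hq : IsUnit q) : IsHermitianPair (p * a * q) (p'ᴴ * c * q) := by
  obtain ⟨⟨u, v, huv⟩, hs⟩ := h
  have hp' : pᴴ * p'ᴴ = 1 := by rw [← conjTranspose_mul, hp, conjTranspose_one]
  obtain ⟨q', hq1, hq2⟩ : ∃ q', q * q' = 1 ∧ q' * q = 1 :=
    ⟨_, hq.mul_val_inv, hq.val_inv_mul⟩
  refine ⟨⟨q' * u * p', q' * v * pᴴ, ?_⟩, ?_⟩
  · calc q' * u * p' * (p * a * q) + q' * v * pᴴ * (p'ᴴ * c * q)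
        = q' * (u * (p' * p) * a + v * (pᴴ * p'ᴴ) * c) * q := by noncomm_ring
      _ = 1 := by rw [hp, hp', mul_one, mul_one, huv, mul_one, hq2]
  · have : (p * a * q)ᴴ * (p'ᴴ * c * q) = qᴴ * (aᴴ * c) * q := by
      rw [conjTranspose_mul, conjTranspose_mul]
      calc qᴴ * (aᴴ * pᴴ) * (p'ᴴ * c * q) = qᴴ * (aᴴ * (pᴴ * p'ᴴ) * c) * q := by noncomm_ring
        _ = _ := by rw [hp', mul_one]
    rw [this, conjTranspose_mul, conjTranspose_mul qᴴ, hs, conjTranspose_conjTranspose, Matrix.mul_assoc,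
      Matrix.mul_assoc, Matrix.mul_assoc]

/-- A shift `s` of the transformed pair pulls back to the congruent matrix `p' * s * p'ᴴ`. -/
theorem HasHermitianShift.of_transform {a c p p' q : Matrix ι ι S} (hp : p' * p = 1)
    (hq : IsUnit q) (h : HasHermitianShift (p * a * q) (p'ᴴ * c * q)) :
    HasHermitianShift a c := by
  obtain ⟨s, hs, hu⟩ := h
  have hp' : p * p' = 1 := mul_eq_one_comm.1 hp
  refine ⟨p' * s * p'ᴴ, ?_, ?_⟩
  · rw [conjTranspose_mul, conjTranspose_mul, hs, conjTranspose_conjTranspose, mul_assoc]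
  · have : p * a * q - s * (p'ᴴ * c * q) = p * (a - p' * s * p'ᴴ * c) * q := by
      calc p * a * q - s * (p'ᴴ * c * q) = p * a * q - 1 * s * (p'ᴴ * c * q) := by rw [one_mul]
        _ = _ := by rw [← hp']; noncomm_ring
    rw [this, hq.mul_right_iff] at hu
    have hpu : IsUnit p := ⟨⟨p, p', hp', hp⟩, rfl⟩
    rwa [hpu.mul_left_iff] at hu

theorem IsHermitianPair.reindex {a c : Matrix ι ι S} (h : IsHermitianPair a c) (e : ι ≃ κ) :
    IsHermitianPair (Matrix.reindex e e a) (Matrix.reindex e e c) := by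
  obtain ⟨⟨u, v, huv⟩, hs⟩ := h
  refine ⟨⟨Matrix.reindex e e u, Matrix.reindex e e v, ?_⟩, ?_⟩
  · simp only [reindex_apply, submatrix_mul_equiv]
    rw [← submatrix_one_equiv e.symm, ← huv]; rfl
  · simp only [reindex_apply, conjTranspose_submatrix, submatrix_mul_equiv]
    rw [hs]

theorem HasHermitianShift.of_reindex {a c : Matrix ι ι S} (e : ι ≃ κ)
    (h : HasHermitianShift (Matrix.reindex e e a) (Matrix.reindex e e c)) :
    HasHermitianShift a c := by
  obtain ⟨s, hs, hu⟩ := h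
  refine ⟨s.submatrix e e, by rw [conjTranspose_submatrix, hs], ?_⟩
  have : a - s.submatrix e e * c =
      (Matrix.reindex e e a - s * Matrix.reindex e e c).submatrix e e := by
    ext i j
    simp [Matrix.mul_apply, ← e.sum_comp]
  rw [this, Matrix.isUnit_iff_isUnit_det, det_submatrix_equiv_self,
    ← Matrix.isUnit_iff_isUnit_det]
  exact hu

/-- Symmetry gives `a₁ᴴ = a₁` and `a₂ = a₃ᴴ * c₄`, so the lower right blocks form a pair of the
smaller size, to which the induction hypothesis applies. -/
theorem HasHermitianShift.of_blocks
    (IH : ∀ a c : Matrix κ κ S, IsHermitianPair a c → HasHermitianShift a c)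
    (a : Matrix (Unit ⊕ κ) (Unit ⊕ κ) S) (c₄ : Matrix κ κ S)
    (h : IsHermitianPair a (fromBlocks 1 0 0 c₄)) :
    HasHermitianShift a (fromBlocks 1 0 0 c₄) := by
  obtain ⟨⟨u, v, huv⟩, hs⟩ := h
  rw [← fromBlocks_toBlocks a, ← fromBlocks_toBlocks u, ← fromBlocks_toBlocks v] at huv
  rw [← fromBlocks_toBlocks a] at hs ⊢
  generalize a.toBlocks₁₁ = a₁ at *
  generalize a.toBlocks₁₂ = a₂ at *
  generalize a.toBlocks₂₁ = a₃ at *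
  generalize a.toBlocks₂₂ = a₄ at *
  simp only [fromBlocks_conjTranspose, fromBlocks_multiply, Matrix.mul_one, Matrix.mul_zero,
    add_zero, zero_add, fromBlocks_inj, conjTranspose_conjTranspose] at hs
  obtain ⟨h1, h2, -, h4⟩ := hs
  simp only [fromBlocks_multiply, fromBlocks_add, ← fromBlocks_one, fromBlocks_inj,
    Matrix.mul_zero, zero_add] at huv
  obtain ⟨-, -, -, huv⟩ := huv
  -- The term `u₂₁ * a₂ = u₂₁ * a₃ᴴ * c₄` of the lower right block is absorbed into the coefficient
  -- of `c₄`.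
  obtain ⟨s, hs, hu⟩ := IH a₄ c₄ ⟨⟨u.toBlocks₂₂, u.toBlocks₂₁ * a₃ᴴ + v.toBlocks₂₂, by
    rw [← huv, h2, add_mul, Matrix.mul_assoc _ a₃ᴴ]; abel⟩, h4⟩
  -- The entry `a₁ - 1` makes the upper left block `1`; the correction `a₃ * a₃ᴴ` cancels `a₃ * a₂`
  -- in the Schur complement, leaving `a₄ - s * c₄`.
  refine ⟨fromBlocks (a₁ - 1) 0 0 (s - a₃ * a₃ᴴ), ?_, ?_⟩
  · simp [fromBlocks_conjTranspose, ← h1, hs, conjTranspose_mul]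
  · have : fromBlocks a₁ a₂ a₃ a₄ - fromBlocks (a₁ - 1) 0 0 (s - a₃ * a₃ᴴ) * fromBlocks 1 0 0 c₄
        = fromBlocks 1 a₂ a₃ (a₄ - (s - a₃ * a₃ᴴ) * c₄) := by
      rw [fromBlocks_multiply, sub_eq_add_neg, fromBlocks_neg, fromBlocks_add]
      simp [sub_eq_add_neg]
    rw [this, Matrix.isUnit_iff_isUnit_det, det_fromBlocks_one₁₁,
      ← Matrix.isUnit_iff_isUnit_det, h2]
    convert hu using 1
    rw [sub_mul, Matrix.mul_assoc a₃]
    abel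

/-- Block elimination at the unit pivot writes `c` as an invertible matrix times `diag(1, d)` times
an invertible matrix, where `d` is the Schur complement. -/
theorem HasHermitianShift.of_pivot
    (IH : ∀ a c : Matrix κ κ S, IsHermitianPair a c → HasHermitianShift a c)
    (a c : Matrix (Unit ⊕ κ) (Unit ⊕ κ) S) (h : IsHermitianPair a c)
    (hc : IsUnit (c (.inl ()) (.inl ()))) : HasHermitianShift a c := by
  have hA : IsUnit c.toBlocks₁₁ := by
    rw [Matrix.isUnit_iff_isUnit_det, det_unique]; exact hc
  obtain ⟨iA⟩ := hA.nonempty_invertible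
  have hdec := fromBlocks_eq_of_invertible₁₁ c.toBlocks₁₁ c.toBlocks₁₂ c.toBlocks₂₁ c.toBlocks₂₂
  rw [fromBlocks_toBlocks] at hdec
  set d := c.toBlocks₂₂ - c.toBlocks₂₁ * ⅟c.toBlocks₁₁ * c.toBlocks₁₂
  set l : Matrix (Unit ⊕ κ) (Unit ⊕ κ) S := fromBlocks 1 0 (c.toBlocks₂₁ * ⅟c.toBlocks₁₁) 1
  set r : Matrix (Unit ⊕ κ) (Unit ⊕ κ) S := fromBlocks 1 (⅟c.toBlocks₁₁ * c.toBlocks₁₂) 0 1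
  set l' : Matrix (Unit ⊕ κ) (Unit ⊕ κ) S := fromBlocks (c.toBlocks₁₁) 0 0 1
  have hl : IsUnit (l * l') := by
    simp only [Matrix.isUnit_iff_isUnit_det, det_mul, l, l', det_fromBlocks_zero₁₂, det_one,
      mul_one, one_mul]
    rwa [← Matrix.isUnit_iff_isUnit_det]
  have hr : IsUnit r := by simp [Matrix.isUnit_iff_isUnit_det, r]
  have hc' : c = l * l' * fromBlocks 1 0 0 d * r := by
    rw [hdec, mul_assoc l l']
    simp [l', fromBlocks_multiply]
  obtain ⟨k, hk1, hk2⟩ : ∃ k, (l * l') * k = 1 ∧ k * (l * l') = 1 :=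
    ⟨_, hl.mul_val_inv, hl.val_inv_mul⟩
  obtain ⟨q, hq1, hq2⟩ : ∃ q, r * q = 1 ∧ q * r = 1 := ⟨_, hr.mul_val_inv, hr.val_inv_mul⟩
  have hp : kᴴ * (l * l')ᴴ = 1 := by rw [← conjTranspose_mul, hk1, conjTranspose_one]
  have hq : IsUnit q := ⟨⟨q, r, hq2, hq1⟩, rfl⟩
  have key : kᴴᴴ * c * q = fromBlocks 1 0 0 d := by
    rw [conjTranspose_conjTranspose, hc']
    calc k * (l * l' * fromBlocks 1 0 0 d * r) * q
        = (k * (l * l')) * fromBlocks 1 0 0 d * (r * q) := by noncomm_ring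
      _ = _ := by rw [hk2, hq1, one_mul, mul_one]
  refine HasHermitianShift.of_transform hp hq ?_
  have := h.transform hp hq
  rw [key] at this ⊢
  exact .of_blocks IH _ _ this

/-- Gaussian elimination: if, for every pair whose first member is not a unit, the second one can be
brought by invertible transformations to a matrix with a unit on a prescribed place of the
diagonal, then all pairs have a Hermitian shift. -/
theorem hasHermitianShift_of_exists_pivot
    (H : ∀ (m : ℕ) (a c : Matrix (Fin m) (Fin m) S), IsHermitianPair a c → IsUnit a ∨
      ∀ i, ∃ p q : Matrix (Fin m) (Fin m) S, IsUnit p ∧ IsUnit q ∧ IsUnit ((p * c * q) i i))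
    (m : ℕ) (a c : Matrix (Fin m) (Fin m) S) (h : IsHermitianPair a c) :
    HasHermitianShift a c := by
  induction m with
  | zero => exact ⟨0, by simp, isUnit_of_subsingleton _⟩
  | succ m ih =>
    obtain ha | hpq := H _ a c h
    · exact ⟨0, by simp, by simpa using ha⟩
    have e : Fin (m + 1) ≃ Unit ⊕ Fin m := Fintype.equivOfCardEq (by simp [add_comm])
    obtain ⟨p, q, hp, hq, hu⟩ := hpq (e.symm (.inl ()))
    obtain ⟨p', h1, h2⟩ : ∃ k, p * k = 1 ∧ k * p = 1 := ⟨_, hp.mul_val_inv, hp.val_inv_mul⟩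
    have hp' : pᴴ * p'ᴴ = 1 := by rw [← conjTranspose_mul, h2, conjTranspose_one]
    -- The transformation is taken with `p'ᴴ` acting on `a`, so that `c` becomes exactly `p * c *
    -- q`.
    refine HasHermitianShift.of_transform hp' hq (.of_reindex e (.of_pivot ih _ _ ?_ ?_))
    · exact (h.transform hp' hq).reindex e
    · rw [conjTranspose_conjTranspose]
      exact hu

end StarPair

/-! ### Units and pivots over a local ring -/

section Local

variable {L L' : Type*} [CommRing L] [IsLocalRing L] [CommRing L'] [IsLocalRing L']

/-- Over the residue field `c` vanishes, so `u` is a left inverse of `a` there; a determinant that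
is nonzero in the residue field is a unit. -/
theorem isUnit_of_mul_add_mul_eq_one_of_not_isUnit {ι : Type*} [Fintype ι] [DecidableEq ι]
    {a c u v : Matrix ι ι L} (h : u * a + v * c = 1) (hc : ∀ i j, ¬ IsUnit (c i j)) :
    IsUnit a := by
  have hc0 : c.map (IsLocalRing.residue L) = 0 := by
    ext i j
    simpa using hc i j
  have := congrArg (RingHom.mapMatrix (IsLocalRing.residue L)) h
  rw [map_add, map_mul, map_mul, map_one] at this
  simp only [RingHom.mapMatrix_apply, hc0, mul_zero, add_zero] at this
  have hu := Matrix.isUnit_det_of_left_inverse this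
  rw [← RingHom.mapMatrix_apply, ← RingHom.map_det] at hu
  exact (Matrix.isUnit_iff_isUnit_det a).2 (isUnit_of_map_unit _ _ hu)

theorem exists_isUnit_mul_mul_apply {R : Type*} [CommRing R] {ι : Type*} [Fintype ι]
    [DecidableEq ι] (c : Matrix ι ι R) (i₀ j₀ i : ι) :
    ∃ p q : Matrix ι ι R, IsUnit p ∧ IsUnit q ∧ (p * c * q) i i = c i₀ j₀ := by
  refine ⟨(Equiv.swap i i₀).permMatrix R, (Equiv.swap i j₀).permMatrix R, ?_, ?_, ?_⟩
  · rw [Matrix.isUnit_iff_isUnit_det, det_permutation]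
    exact (Units.isUnit _).map (Int.castRingHom R)
  · rw [Matrix.isUnit_iff_isUnit_det, det_permutation]
    exact (Units.isUnit _).map (Int.castRingHom R)
  · simp [Equiv.Perm.permMatrix, PEquiv.toMatrix_toPEquiv_mul, PEquiv.mul_toMatrix_toPEquiv]

end Local

section StarLocal

variable {L : Type*} [CommRing L] [IsLocalRing L] [StarRing L]

theorem IsHermitianPair.hasHermitianShift_of_isLocalRing {m : ℕ} {a c : Matrix (Fin m) (Fin m) L}
    (h : IsHermitianPair a c) : HasHermitianShift a c := by
  refine hasHermitianShift_of_exists_pivot (fun m a c h ↦ ?_) m a c h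
  obtain ⟨⟨u, v, huv⟩, -⟩ := h
  by_cases hc : ∀ i j, ¬ IsUnit (c i j)
  · exact .inl (isUnit_of_mul_add_mul_eq_one_of_not_isUnit huv hc)
  · push Not at hc
    obtain ⟨i₀, j₀, hc⟩ := hc
    refine .inr fun i ↦ ?_
    obtain ⟨p, q, hp, hq, hpq⟩ := exists_isUnit_mul_mul_apply c i₀ j₀ i
    exact ⟨p, q, hp, hq, hpq ▸ hc⟩

end StarLocal

/-! ### Two local rings exchanged by the involution -/

section Pair

variable {L L' : Type*} [CommRing L] [CommRing L']

/-- The matrix over a product ring with given components. -/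
def Matrix.prodMk {ι : Type*} (M : Matrix ι ι L) (M' : Matrix ι ι L') : Matrix ι ι (L × L') :=
  Matrix.of fun i j ↦ (M i j, M' i j)

section

variable {ι : Type*} (M : Matrix ι ι L) (M' : Matrix ι ι L')

theorem Matrix.mapMatrix_fst_prodMk [Fintype ι] [DecidableEq ι] :
    (RingHom.fst L L').mapMatrix (M.prodMk M') = M := rfl

theorem Matrix.mapMatrix_snd_prodMk [Fintype ι] [DecidableEq ι] :
    (RingHom.snd L L').mapMatrix (M.prodMk M') = M' := rfl

theorem Matrix.prod_ext [Fintype ι] [DecidableEq ι] {N N' : Matrix ι ι (L × L')}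
    (h : (RingHom.fst L L').mapMatrix N = (RingHom.fst L L').mapMatrix N')
    (h' : (RingHom.snd L L').mapMatrix N = (RingHom.snd L L').mapMatrix N') : N = N' := by
  ext i j
  exacts [congrFun₂ h i j, congrFun₂ h' i j]

end

theorem Matrix.isUnit_prod_iff {ι : Type*} [Fintype ι] [DecidableEq ι]
    {N : Matrix ι ι (L × L')} :
    IsUnit N ↔ IsUnit ((RingHom.fst L L').mapMatrix N) ∧
      IsUnit ((RingHom.snd L L').mapMatrix N) := by
  rw [Matrix.isUnit_iff_isUnit_det, Matrix.isUnit_iff_isUnit_det, Matrix.isUnit_iff_isUnit_det,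
    ← RingHom.map_det, ← RingHom.map_det, Prod.isUnit_iff]
  rfl

/-- Here `c = b⁻¹ * d * a` is a left multiple of `a`, so coprimality yields a left inverse of `a`.
It transfers invertibility of `a` from one factor to the other. -/
theorem isUnit_of_mul_eq_mul_of_isUnit {R : Type*} [CommRing R] {ι : Type*} [Fintype ι]
    [DecidableEq ι] {a b c d u v : Matrix ι ι R} (hb : IsUnit b) (h : d * a = b * c)
    (huv : u * a + v * c = 1) : IsUnit a := by
  obtain ⟨x, hx⟩ : ∃ x, x * b = 1 := ⟨_, hb.val_inv_mul⟩
  have : (u + v * x * d) * a = 1 := by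
    calc (u + v * x * d) * a = u * a + v * x * (d * a) := by noncomm_ring
      _ = u * a + v * (x * b) * c := by rw [h]; noncomm_ring
      _ = 1 := by rw [hx, mul_one, huv]
  exact (Matrix.isUnit_iff_isUnit_det a).2 (Matrix.isUnit_det_of_left_inverse this)

theorem isUnit_transpose_map {R R' : Type*} [CommRing R] [CommRing R'] {ι : Type*} [Fintype ι]
    [DecidableEq ι] (f : R →+* R') {a : Matrix ι ι R} (ha : IsUnit a) : IsUnit (a.map f)ᵀ :=
  (Matrix.isUnit_transpose _).2 (ha.map f.mapMatrix)

/-- The involution of `L × L'` which exchanges the factors through inverse isomorphisms. -/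
@[reducible]
def flipStarRing (τ : L →+* L') (τ' : L' →+* L) (h : ∀ x, τ' (τ x) = x) (h' : ∀ x, τ (τ' x) = x) :
    StarRing (L × L') where
  star x := (τ' x.2, τ x.1)
  star_involutive x := Prod.ext (h _) (h' _)
  star_mul x y := by ext <;> simp [mul_comm]
  star_add x y := by ext <;> simp

variable [IsLocalRing L] [IsLocalRing L']

theorem exists_shift_of_flip (τ : L →+* L') (τ' : L' →+* L) (h : ∀ x, τ' (τ x) = x)
    (h' : ∀ x, τ (τ' x) = x) {m : ℕ} {a c u v : Matrix (Fin m) (Fin m) L}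
    {a' c' u' v' : Matrix (Fin m) (Fin m) L'} (huv : u * a + v * c = 1)
    (huv' : u' * a' + v' * c' = 1) (hs : (c'.map τ')ᵀ * a = (a'.map τ')ᵀ * c)
    (hs' : (c.map τ)ᵀ * a' = (a.map τ)ᵀ * c') :
    ∃ (s : Matrix (Fin m) (Fin m) L) (s' : Matrix (Fin m) (Fin m) L'),
      s = (s'.map τ')ᵀ ∧ s' = (s.map τ)ᵀ ∧ IsUnit (a - s * c) ∧ IsUnit (a' - s' * c') := by
  let : StarRing (L × L') := flipStarRing τ τ' h h'
  have map_ct (m : ℕ) (N : Matrix (Fin m) (Fin m) (L × L')) :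
      (RingHom.fst L L').mapMatrix Nᴴ = (((RingHom.snd L L').mapMatrix N).map τ')ᵀ := rfl
  have map_ct' (m : ℕ) (N : Matrix (Fin m) (Fin m) (L × L')) :
      (RingHom.snd L L').mapMatrix Nᴴ = (((RingHom.fst L L').mapMatrix N).map τ)ᵀ := rfl
  have key : HasHermitianShift (a.prodMk a') (c.prodMk c') := by
    refine hasHermitianShift_of_exists_pivot (fun m a c h ↦ ?_) m _ _
      ⟨⟨u.prodMk u', v.prodMk v', ?_⟩, ?_⟩
    · obtain ⟨⟨u, v, huv⟩, hs⟩ := h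
      have huv₁ := congrArg (RingHom.fst L L').mapMatrix huv
      have huv₂ := congrArg (RingHom.snd L L').mapMatrix huv
      have hs₁ := congrArg (RingHom.fst L L').mapMatrix hs
      have hs₂ := congrArg (RingHom.snd L L').mapMatrix hs
      rw [conjTranspose_mul, conjTranspose_conjTranspose, map_mul, map_mul] at hs₁ hs₂
      rw [map_ct, map_ct] at hs₁
      rw [map_ct', map_ct'] at hs₂
      rw [map_add, map_mul, map_mul, map_one] at huv₁ huv₂
      rw [Matrix.isUnit_prod_iff]
      -- The product is not local: a component of `c` without unit entries makes only its own
      -- component of `a` a unit directly, and the symmetry relation gives the other.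
      by_cases hc₁ : ∀ i j, ¬ IsUnit ((RingHom.fst L L').mapMatrix c i j)
      · have ha := isUnit_of_mul_add_mul_eq_one_of_not_isUnit huv₁ hc₁
        exact .inl ⟨ha, isUnit_of_mul_eq_mul_of_isUnit (isUnit_transpose_map τ ha) hs₂ huv₂⟩
      by_cases hc₂ : ∀ i j, ¬ IsUnit ((RingHom.snd L L').mapMatrix c i j)
      · have ha := isUnit_of_mul_add_mul_eq_one_of_not_isUnit huv₂ hc₂
        exact .inl ⟨isUnit_of_mul_eq_mul_of_isUnit (isUnit_transpose_map τ' ha) hs₁ huv₁, ha⟩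
      right
      push Not at hc₁ hc₂
      obtain ⟨i₁, j₁, hc₁⟩ := hc₁
      obtain ⟨i₂, j₂, hc₂⟩ := hc₂
      intro i
      obtain ⟨p₁, q₁, hp₁, hq₁, hpq₁⟩ :=
        exists_isUnit_mul_mul_apply ((RingHom.fst L L').mapMatrix c) i₁ j₁ i
      obtain ⟨p₂, q₂, hp₂, hq₂, hpq₂⟩ :=
        exists_isUnit_mul_mul_apply ((RingHom.snd L L').mapMatrix c) i₂ j₂ i
      -- The unit entries may sit at different positions in the two components; each is moved to
      -- `(i, i)` independently.
      refine ⟨p₁.prodMk p₂, q₁.prodMk q₂, Matrix.isUnit_prod_iff.2 ⟨hp₁, hp₂⟩,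
        Matrix.isUnit_prod_iff.2 ⟨hq₁, hq₂⟩, Prod.isUnit_iff.2 ⟨?_, ?_⟩⟩
      · rw [← hpq₁] at hc₁
        convert hc₁
        change (RingHom.fst L L').mapMatrix (p₁.prodMk p₂ * c * q₁.prodMk q₂) i i = _
        rw [map_mul, map_mul]
        rfl
      · rw [← hpq₂] at hc₂
        convert hc₂
        change (RingHom.snd L L').mapMatrix (p₁.prodMk p₂ * c * q₁.prodMk q₂) i i = _
        rw [map_mul, map_mul]
        rfl
    · apply Matrix.prod_ext <;> rw [map_add, map_mul, map_mul, map_one]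
      exacts [huv, huv']
    · rw [conjTranspose_mul, conjTranspose_conjTranspose]
      apply Matrix.prod_ext <;> rw [map_mul, map_mul]
      exacts [hs, hs']
  obtain ⟨s, hs, hu⟩ := key
  rw [Matrix.isUnit_prod_iff, map_sub, map_mul, map_sub, map_mul] at hu
  refine ⟨(RingHom.fst L L').mapMatrix s, (RingHom.snd L L').mapMatrix s, ?_, ?_, hu.1, hu.2⟩
  · rw [← map_ct, hs]
  · rw [← map_ct', hs]

theorem exists_shift_of_involution (θ : L →+* L) (h : ∀ x, θ (θ x) = x) {m : ℕ}
    {a c u v : Matrix (Fin m) (Fin m) L} (huv : u * a + v * c = 1)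
    (hs : (c.map θ)ᵀ * a = (a.map θ)ᵀ * c) :
    ∃ s : Matrix (Fin m) (Fin m) L, s = (s.map θ)ᵀ ∧ IsUnit (a - s * c) := by
  let : StarRing L :=
    { star := θ
      star_involutive := h
      star_mul := fun x y ↦ by rw [map_mul, mul_comm]
      star_add := map_add θ }
  obtain ⟨s, h1, h2⟩ := IsHermitianPair.hasHermitianShift_of_isLocalRing (a := a) (c := c)
    ⟨⟨u, v, huv⟩, by rw [conjTranspose_mul, conjTranspose_conjTranspose]; exact hs⟩
  exact ⟨s, h1.symm, h2⟩

end Pair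

/-! ### Solutions with entries in valuation rings -/

section Integral

/-- All entries of the matrix lie in the given valuation ring. -/
def Matrix.IsIntegral {K : Type*} [Field K] {ι : Type*} (O : ValuationSubring K)
    (M : Matrix ι ι K) : Prop :=
  ∀ i j, M i j ∈ O

theorem Matrix.IsIntegral.exists_map_eq {K : Type*} [Field K] {ι : Type*} [Fintype ι]
    [DecidableEq ι] {O : ValuationSubring K} {M : Matrix ι ι K} (h : M.IsIntegral O) :
    ∃ N : Matrix ι ι O, O.subtype.mapMatrix N = M :=
  ⟨Matrix.of fun i j ↦ ⟨M i j, h i j⟩, rfl⟩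

theorem Matrix.isIntegral_map {K : Type*} [Field K] {ι : Type*} [Fintype ι] [DecidableEq ι]
    (O : ValuationSubring K) (N : Matrix ι ι O) :
    (O.subtype.mapMatrix N).IsIntegral O :=
  fun i j ↦ (N i j).2

theorem ValuationSubring.mapMatrix_subtype_injective {K : Type*} [Field K] {ι : Type*} [Fintype ι]
    [DecidableEq ι] (O : ValuationSubring K) :
    Function.Injective (O.subtype.mapMatrix : Matrix ι ι O →+* Matrix ι ι K) :=
  Matrix.map_injective Subtype.val_injective

/-- The restriction of a ring homomorphism to valuation rings. -/
def ValuationSubring.restrictHom {K K' : Type*} [Field K] [Field K'] (O : ValuationSubring K)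
    (O' : ValuationSubring K') (τ : K →+* K') (h : ∀ x ∈ O, τ x ∈ O') : O →+* O' :=
  (τ.comp O.subtype).codRestrict O' fun x ↦ h x x.2

theorem ValuationSubring.mapMatrix_transpose_map_restrictHom {K K' : Type*} [Field K] [Field K']
    (O : ValuationSubring K) (O' : ValuationSubring K') (τ : K →+* K') (h : ∀ x ∈ O, τ x ∈ O')
    {ι : Type*} [Fintype ι] [DecidableEq ι] (N : Matrix ι ι O) :
    O'.subtype.mapMatrix (N.map (O.restrictHom O' τ h))ᵀ =
      ((O.subtype.mapMatrix N).map τ)ᵀ := rfl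

variable {K K' : Type*} [Field K] [Field K'] {m : ℕ}

/-- The valuation rings are local, so the shift exists over them. The inverse `b` is recorded
because it too must be integral almost everywhere to be adelic. Taking `⊤` for both rings gives the
case of fields. -/
theorem exists_integral_shift_of_flip (O : ValuationSubring K) (O' : ValuationSubring K')
    (τ : K →+* K') (τ' : K' →+* K) (h : ∀ x, τ' (τ x) = x) (h' : ∀ x, τ (τ' x) = x)
    (hO : ∀ x ∈ O, τ x ∈ O') (hO' : ∀ x ∈ O', τ' x ∈ O)
    {a c u v : Matrix (Fin m) (Fin m) K}
    {a' c' u' v' : Matrix (Fin m) (Fin m) K'} (huv : u * a + v * c = 1)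
    (huv' : u' * a' + v' * c' = 1) (hs : (c'.map τ')ᵀ * a = (a'.map τ')ᵀ * c)
    (hs' : (c.map τ)ᵀ * a' = (a.map τ)ᵀ * c')
    (ha : a.IsIntegral O) (hc : c.IsIntegral O) (hu : u.IsIntegral O) (hv : v.IsIntegral O)
    (ha' : a'.IsIntegral O') (hc' : c'.IsIntegral O') (hu' : u'.IsIntegral O')
    (hv' : v'.IsIntegral O') :
    ∃ (s b : Matrix (Fin m) (Fin m) K) (s' b' : Matrix (Fin m) (Fin m) K'),
      s = (s'.map τ')ᵀ ∧ s' = (s.map τ)ᵀ ∧ (a - s * c) * b = 1 ∧ (a' - s' * c') * b' = 1 ∧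
      s.IsIntegral O ∧ b.IsIntegral O ∧ s'.IsIntegral O' ∧ b'.IsIntegral O' := by
  obtain ⟨a, rfl⟩ := ha.exists_map_eq
  obtain ⟨c, rfl⟩ := hc.exists_map_eq
  obtain ⟨u, rfl⟩ := hu.exists_map_eq
  obtain ⟨v, rfl⟩ := hv.exists_map_eq
  obtain ⟨a', rfl⟩ := ha'.exists_map_eq
  obtain ⟨c', rfl⟩ := hc'.exists_map_eq
  obtain ⟨u', rfl⟩ := hu'.exists_map_eq
  obtain ⟨v', rfl⟩ := hv'.exists_map_eq
  obtain ⟨s, s', h1, h2, h3, h4⟩ := exists_shift_of_flip (O.restrictHom O' τ hO)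
    (O'.restrictHom O τ' hO') (fun x ↦ Subtype.ext (h x)) (fun x ↦ Subtype.ext (h' x))
    (a := a) (c := c) (u := u) (v := v) (a' := a') (c' := c') (u' := u') (v' := v')
    (O.mapMatrix_subtype_injective <| by simpa only [map_add, map_mul, map_one] using huv)
    (O'.mapMatrix_subtype_injective <| by simpa only [map_add, map_mul, map_one] using huv')
    (O.mapMatrix_subtype_injective <| by
      simpa only [map_mul, ValuationSubring.mapMatrix_transpose_map_restrictHom] using hs)
    (O'.mapMatrix_subtype_injective <| by
      simpa only [map_mul, ValuationSubring.mapMatrix_transpose_map_restrictHom] using hs')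
  obtain ⟨b, hb⟩ : ∃ b, (a - s * c) * b = 1 := ⟨_, h3.mul_val_inv⟩
  obtain ⟨b', hb'⟩ : ∃ b, (a' - s' * c') * b = 1 := ⟨_, h4.mul_val_inv⟩
  refine ⟨O.subtype.mapMatrix s, O.subtype.mapMatrix b, O'.subtype.mapMatrix s',
    O'.subtype.mapMatrix b', congrArg O.subtype.mapMatrix h1, congrArg O'.subtype.mapMatrix h2,
    ?_, ?_, isIntegral_map _ _, isIntegral_map _ _, isIntegral_map _ _, isIntegral_map _ _⟩
  · rw [← map_mul, ← map_sub, ← map_mul, hb, map_one]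
  · rw [← map_mul, ← map_sub, ← map_mul, hb', map_one]

theorem exists_integral_shift_of_involution (O : ValuationSubring K)
    (θ : K →+* K) (h : ∀ x, θ (θ x) = x) (hO : ∀ x ∈ O, θ x ∈ O)
    {a c u v : Matrix (Fin m) (Fin m) K} (huv : u * a + v * c = 1)
    (hs : (c.map θ)ᵀ * a = (a.map θ)ᵀ * c)
    (ha : a.IsIntegral O) (hc : c.IsIntegral O) (hu : u.IsIntegral O) (hv : v.IsIntegral O) :
    ∃ s b : Matrix (Fin m) (Fin m) K,
      s = (s.map θ)ᵀ ∧ (a - s * c) * b = 1 ∧ s.IsIntegral O ∧ b.IsIntegral O := by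
  obtain ⟨a, rfl⟩ := ha.exists_map_eq
  obtain ⟨c, rfl⟩ := hc.exists_map_eq
  obtain ⟨u, rfl⟩ := hu.exists_map_eq
  obtain ⟨v, rfl⟩ := hv.exists_map_eq
  obtain ⟨s, h1, h2⟩ := exists_shift_of_involution (O.restrictHom O θ hO)
    (fun x ↦ Subtype.ext (h x)) (a := a) (c := c) (u := u) (v := v)
    (O.mapMatrix_subtype_injective <| by simpa only [map_add, map_mul, map_one] using huv)
    (O.mapMatrix_subtype_injective <| by
      simpa only [map_mul, ValuationSubring.mapMatrix_transpose_map_restrictHom] using hs)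
  obtain ⟨b, hb⟩ : ∃ b, (a - s * c) * b = 1 := ⟨_, h2.mul_val_inv⟩
  refine ⟨O.subtype.mapMatrix s, O.subtype.mapMatrix b, congrArg O.subtype.mapMatrix h1, ?_,
    isIntegral_map _ _, isIntegral_map _ _⟩
  rw [← map_mul, ← map_sub, ← map_mul, hb, map_one]

end Integral

/-! ### Gluing over the orbits of an involution -/

section Glue

/-- Families satisfying a relation along an involution of the index set can be
chosen orbit by orbit. -/
theorem exists_forall_of_involutive {ι : Type*} {X : ι → Type*} (σ : ι → ι)
    (hσ : ∀ i, σ (σ i) = i) (P : ∀ i j, σ i = j → X i → X j → Prop)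
    (h₁ : ∀ i (h : σ i = i), ∃ x, P i i h x x)
    (h₂ : ∀ i j (h : σ i = j) (h' : σ j = i), i ≠ j → ∃ x y, P i j h x y ∧ P j i h' y x) :
    ∃ x : ∀ i, X i, ∀ i, P i (σ i) rfl (x i) (x (σ i)) := by
  classical
  -- The order only serves to select one element of each two-element orbit: the smaller index
  -- receives `g`, the larger `g'`.
  let : LinearOrder ι := linearOrderOfSTO WellOrderingRel
  choose f hf using h₁
  choose g g' hg hg' using h₂
  let x (i : ι) : X i :=
    if h : σ i = i then f i h
    else if i < σ i then g i (σ i) rfl (hσ i) (Ne.symm h)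
    else g' (σ i) i (hσ i) rfl h
  suffices H : ∀ i j (h : σ i = j), P i j h (x i) (x j) from ⟨x, fun i ↦ H i _ rfl⟩
  intro i j h
  have h' : σ j = i := by rw [← h, hσ]
  by_cases hij : i = j
  · subst hij
    simp only [x, dif_pos h]
    exact hf i h
  · have hx : x i = if i < j then g i j h h' hij else g' j i h' h (Ne.symm hij) := by
      subst h
      simp only [x, dif_neg (Ne.symm hij)]
    have hy : x j = if j < i then g j i h' h (Ne.symm hij) else g' i j h h' hij := by
      subst h'
      simp only [x, dif_neg hij]
    rw [hx, hy]
    rcases lt_or_gt_of_ne hij with hlt | hlt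
    · rw [if_pos hlt, if_neg hlt.not_gt]
      exact hg ..
    · rw [if_pos hlt, if_neg hlt.not_gt]
      exact hg' ..

theorem exists_shift_of_forall_field {ι : Type*} {K : ι → Type*} [∀ i, Field (K i)] {m : ℕ}
    (O : ∀ i, ValuationSubring (K i)) (σ : ι → ι) (hσ : ∀ i, σ (σ i) = i)
    (τ : ∀ i j, σ i = j → K j →+* K i) (hτ : ∀ i j h h' x, τ i j h (τ j i h' x) = x)
    (hO : ∀ i j h, ∀ x ∈ O j, τ i j h x ∈ O i) (a c u v : ∀ i, Matrix (Fin m) (Fin m) (K i))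
    (huv : ∀ i, u i * a i + v i * c i = 1)
    (hs : ∀ i j h, ((c j).map (τ i j h))ᵀ * a i = ((a j).map (τ i j h))ᵀ * c i) :
    ∃ s b : ∀ i, Matrix (Fin m) (Fin m) (K i), ∀ i, s i = ((s (σ i)).map (τ i (σ i) rfl))ᵀ ∧
      (a i - s i * c i) * b i = 1 ∧
      ((∀ j, j = i ∨ j = σ i → (a j).IsIntegral (O j) ∧ (c j).IsIntegral (O j) ∧
        (u j).IsIntegral (O j) ∧ (v j).IsIntegral (O j)) →
        (s i).IsIntegral (O i) ∧ (b i).IsIntegral (O i)) := by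
  have top {i : ι} (M : Matrix (Fin m) (Fin m) (K i)) : M.IsIntegral ⊤ := fun _ _ ↦ trivial
  let G (i : ι) : Prop := (a i).IsIntegral (O i) ∧ (c i).IsIntegral (O i) ∧
    (u i).IsIntegral (O i) ∧ (v i).IsIntegral (O i)
  -- Integrality is claimed only when the data are integral at both places of the orbit; otherwise
  -- the rings are replaced by `⊤`.
  refine Exists.elim (exists_forall_of_involutive
    (X := fun i ↦ Matrix (Fin m) (Fin m) (K i) × Matrix (Fin m) (Fin m) (K i)) σ hσ
    (fun i j h x y ↦ x.1 = (y.1.map (τ i j h))ᵀ ∧ (a i - x.1 * c i) * x.2 = 1 ∧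
      (G i → G j → x.1.IsIntegral (O i) ∧ x.2.IsIntegral (O i))) ?_ ?_)
    fun x hx ↦ ⟨fun i ↦ (x i).1, fun i ↦ (x i).2, fun i ↦ ⟨(hx i).1, (hx i).2.1,
      fun h ↦ (hx i).2.2 (h _ (.inl rfl)) (h _ (.inr rfl))⟩⟩
  · intro i h
    by_cases hG : G i
    · obtain ⟨s, b, h1, h2, h3⟩ := exists_integral_shift_of_involution (O i) (τ i i h)
        (hτ i i h h) (hO i i h) (huv i) (hs i i h) hG.1 hG.2.1 hG.2.2.1 hG.2.2.2
      exact ⟨(s, b), h1, h2, fun _ _ ↦ h3⟩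
    · obtain ⟨s, b, h1, h2, -⟩ := exists_integral_shift_of_involution ⊤ (τ i i h)
        (hτ i i h h) (fun _ _ ↦ trivial) (huv i) (hs i i h) (top _) (top _) (top _) (top _)
      exact ⟨(s, b), h1, h2, fun h ↦ absurd h hG⟩
  · intro i j h h' _
    by_cases hG : G i ∧ G j
    · obtain ⟨⟨ha, hc, hu, hv⟩, ha', hc', hu', hv'⟩ := hG
      obtain ⟨s, b, s', b', h1, h2, h3, h4, h5, h6, h7, h8⟩ :=
        exists_integral_shift_of_flip (O i) (O j) (τ j i h') (τ i j h) (hτ i j h h')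
          (hτ j i h' h) (hO _ _ _) (hO _ _ _) (huv i) (huv j) (hs i j h) (hs j i h')
          ha hc hu hv ha' hc' hu' hv'
      exact ⟨(s, b), (s', b'), ⟨h1, h3, fun _ _ ↦ ⟨h5, h6⟩⟩, ⟨h2, h4, fun _ _ ↦ ⟨h7, h8⟩⟩⟩
    · obtain ⟨s, b, s', b', h1, h2, h3, h4, -⟩ :=
        exists_integral_shift_of_flip ⊤ ⊤ (τ j i h') (τ i j h) (hτ i j h h')
          (hτ j i h' h) (fun _ _ ↦ trivial) (fun _ _ ↦ trivial) (huv i) (huv j) (hs i j h)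
          (hs j i h') (top _) (top _) (top _) (top _) (top _) (top _) (top _) (top _)
      exact ⟨(s, b), (s', b'), ⟨h1, h3, fun p q ↦ absurd ⟨p, q⟩ hG⟩,
        ⟨h2, h4, fun p q ↦ absurd ⟨q, p⟩ hG⟩⟩

end Glue

namespace GlobalField

/-! ### Existence of a finite place -/

section Nontrivial

/-- The image of `d` generates a proper ideal of the image of `D`, so some valuation ring of `E` has
it as a nonunit. As the image is nonzero, that ring is not all of `E`. -/
theorem nonempty_finitePlace_of_injective {D E : Type*} [CommRing D] [Field E] (f : D →+* E)
    (hf : Function.Injective f) {d : D} (hd : ¬ IsUnit d) (hd0 : d ≠ 0) :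
    Nonempty (FinitePlace E) := by
  have hd' : ¬ IsUnit (f.rangeRestrict d) := fun h ↦ hd <| by
    obtain ⟨⟨_, x, rfl⟩, hx⟩ := h.exists_right_inv
    refine IsUnit.of_mul_eq_one x (hf ?_)
    simpa using congrArg Subtype.val hx
  obtain ⟨B, -, hB⟩ := Ideal.image_subset_nonunits_valuationSubring (A := f.range)
    (Ideal.span {f.rangeRestrict d}) (by rwa [Ne, Ideal.span_singleton_eq_top])
  refine ⟨⟨B, fun h ↦ ?_⟩⟩
  have := hB ⟨_, Ideal.mem_span_singleton_self _, rfl⟩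
  subst h
  obtain h | h := (ValuationSubring.mem_nonunits_iff_or _).1 this
  · exact hd0 (hf (h.trans (map_zero f).symm))
  · exact h (ValuationSubring.mem_top _)

theorem IsGlobalField.nonempty_finitePlace {F : Type*} [Field F] (hF : IsGlobalField F)
    (E : Type*) [Field E] [Algebra F E] : Nonempty (FinitePlace E) := by
  obtain h | ⟨p, hp, hA, -⟩ := hF
  · exact nonempty_finitePlace_of_injective ((algebraMap F E).comp (Int.castRingHom F))
      ((algebraMap F E).injective.comp Int.cast_injective) (d := 2) (by decide) two_ne_zero
  · exact nonempty_finitePlace_of_injective ((algebraMap F E).comp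
      ((algebraMap (RatFunc (ZMod p)) F).comp (algebraMap (Polynomial (ZMod p)) _)))
      ((algebraMap F E).injective.comp ((algebraMap (RatFunc (ZMod p)) F).injective.comp
        (RatFunc.algebraMap_injective (ZMod p)))) Polynomial.not_isUnit_X Polynomial.X_ne_zero

theorem nontrivial_adeleRing {E : Type*} [Field E] [h : Nonempty (FinitePlace E)] :
    Nontrivial (AdeleRing E) := by
  obtain ⟨v⟩ := h
  refine ⟨0, 1, fun h ↦ zero_ne_one (α := v.Completion) ?_⟩
  exact congrArg (fun x : AdeleRing E ↦ x.2 v) h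

end Nontrivial

/-! ### From local to adelic shifts -/

section Shift

variable {E : Type*} [Field E] (σ : E ≃+* E) {m : ℕ}

open NumberField

theorem FinitePlace.comap_comap (hσ : ∀ x, σ (σ x) = x) (w : FinitePlace E) : (w.comap σ).comap σ = w := by
  apply Subtype.ext
  ext y
  simp [FinitePlace.comap, ValuationSubring.mem_comap, hσ]

/-- The component of an adelic matrix at an infinite place. -/
noncomputable def infComponent (w : InfinitePlace E) :
    Matrix (Fin m) (Fin m) (AdeleRing E) →+* Matrix (Fin m) (Fin m) w.Completion :=
  ((Pi.evalRingHom _ w).comp (RingHom.fst _ _)).mapMatrix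

/-- The component of an adelic matrix at a finite place. -/
noncomputable def finComponent (w : FinitePlace E) :
    Matrix (Fin m) (Fin m) (AdeleRing E) →+* Matrix (Fin m) (Fin m) w.Completion :=
  ((RestrictedProduct.evalRingHom _ w).comp (RingHom.snd _ _)).mapMatrix

theorem matrix_ext {M N : Matrix (Fin m) (Fin m) (AdeleRing E)}
    (h₁ : ∀ w, infComponent w M = infComponent w N)
    (h₂ : ∀ w, finComponent w M = finComponent w N) : M = N := by
  refine Matrix.ext fun k l ↦ Prod.ext (funext fun w ↦ congrFun₂ (h₁ w) k l)
    (RestrictedProduct.ext _ _ fun w ↦ congrFun₂ (h₂ w) k l)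

theorem infComponent_adeleMap (w : InfinitePlace E) (M : Matrix (Fin m) (Fin m) (AdeleRing E)) :
    infComponent w (M.map (adeleMap σ))ᵀ =
      ((infComponent (w.comap (σ : E →+* E)) M).map (infiniteMap σ _ w fun _ ↦ rfl))ᵀ := rfl

theorem finComponent_adeleMap (w : FinitePlace E) (M : Matrix (Fin m) (Fin m) (AdeleRing E)) :
    finComponent w (M.map (adeleMap σ))ᵀ =
      ((finComponent (w.comap σ) M).map (finiteMap σ _ w fun _ ↦ Iff.rfl))ᵀ := rfl

theorem eventually_isIntegral_finComponent (M : Matrix (Fin m) (Fin m) (AdeleRing E)) :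
    ∀ᶠ w in Filter.cofinite, (finComponent w M).IsIntegral w.integers := by
  simp only [Matrix.IsIntegral, Filter.eventually_all]
  exact fun i j ↦ (M i j).2.2

theorem exists_finComponent_eq (x : ∀ w : InfinitePlace E, Matrix (Fin m) (Fin m) w.Completion)
    (y : ∀ w : FinitePlace E, Matrix (Fin m) (Fin m) w.Completion)
    (hy : ∀ᶠ w in Filter.cofinite, (y w).IsIntegral w.integers) :
    ∃ M : Matrix (Fin m) (Fin m) (AdeleRing E),
      (∀ w, infComponent w M = x w) ∧ ∀ w, finComponent w M = y w :=
  ⟨Matrix.of fun i j ↦ (fun w ↦ x w i j, ⟨fun w ↦ y w i j, hy.mono fun _ h ↦ h i j⟩),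
    fun _ ↦ rfl, fun _ ↦ rfl⟩

theorem exists_adele_shift (hσ : ∀ x, σ (σ x) = x)
    {a c u v : Matrix (Fin m) (Fin m) (AdeleRing E)} (huv : u * a + v * c = 1)
    (hs : (c.map (adeleMap σ))ᵀ * a = (a.map (adeleMap σ))ᵀ * c) :
    ∃ s b : Matrix (Fin m) (Fin m) (AdeleRing E),
      s = (s.map (adeleMap σ))ᵀ ∧ (a - s * c) * b = 1 := by
  -- Archimedean components carry no integrality condition, hence `⊤`.
  obtain ⟨s₁, b₁, h₁⟩ := exists_shift_of_forall_field
    (K := fun w : InfinitePlace E ↦ w.Completion) (fun _ ↦ ⊤) (fun w ↦ w.comap (σ : E →+* E))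
    (fun w ↦ by ext y; simp [hσ])
    (fun w w' h ↦ infiniteMap σ w' w fun x ↦ by subst h; rfl)
    (fun w w' h h' x ↦ infiniteMap_infiniteMap σ hσ ..) (fun _ _ _ _ _ ↦ trivial)
    (fun w ↦ infComponent w a) (fun w ↦ infComponent w c) (fun w ↦ infComponent w u)
    (fun w ↦ infComponent w v)
    (fun w ↦ by simpa only [map_add, map_mul, map_one] using congrArg (infComponent w) huv)
    (fun w w' h ↦ by
      subst h
      simpa only [map_mul, infComponent_adeleMap] using congrArg (infComponent w) hs)
  let (w : FinitePlace E) : Field w.Completion := inferInstance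
  obtain ⟨s₂, b₂, h₂⟩ := exists_shift_of_forall_field
    (K := fun w : FinitePlace E ↦ w.Completion) (fun w ↦ w.integers) (fun w ↦ w.comap σ)
    (FinitePlace.comap_comap σ hσ)
    (fun w w' h ↦ finiteMap σ w' w fun x ↦ by subst h; rfl)
    (fun w w' h h' x ↦ finiteMap_finiteMap σ hσ ..)
    (fun w w' h x ↦ finiteMap_mem_integers σ w' w _ x)
    (fun w ↦ finComponent w a) (fun w ↦ finComponent w c) (fun w ↦ finComponent w u)
    (fun w ↦ finComponent w v)
    (fun w ↦ by simpa only [map_add, map_mul, map_one] using congrArg (finComponent w) huv)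
    (fun w w' h ↦ by
      subst h
      simpa only [map_mul, finComponent_adeleMap] using congrArg (finComponent w) hs)
  have hint : ∀ᶠ w : FinitePlace E in Filter.cofinite,
      (s₂ w).IsIntegral w.integers ∧ (b₂ w).IsIntegral w.integers := by
    have hG := (eventually_isIntegral_finComponent a).and
      ((eventually_isIntegral_finComponent c).and
        ((eventually_isIntegral_finComponent u).and (eventually_isIntegral_finComponent v)))
    -- Since `comap σ` is injective, the data are integral at both `w` and `w.comap σ` for almost
    -- all `w`.
    filter_upwards [hG, (FinitePlace.comap_injective σ).tendsto_cofinite.eventually hG]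
      with w hw hw'
    refine (h₂ w).2.2 ?_
    rintro _ (rfl | rfl)
    exacts [hw, hw']
  obtain ⟨s, hs₁, hs₂⟩ := exists_finComponent_eq s₁ s₂ (hint.mono fun _ h ↦ h.1)
  obtain ⟨b, hb₁, hb₂⟩ := exists_finComponent_eq b₁ b₂ (hint.mono fun _ h ↦ h.2)
  refine ⟨s, b, matrix_ext (fun w ↦ ?_) (fun w ↦ ?_), matrix_ext (fun w ↦ ?_) (fun w ↦ ?_)⟩
  · rw [infComponent_adeleMap, hs₁, hs₁]
    exact (h₁ w).1
  · rw [finComponent_adeleMap, hs₂, hs₂]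
    exact (h₂ w).1
  · rw [map_mul, map_sub, map_mul, hs₁, hb₁, map_one]
    exact (h₁ w).2.1
  · rw [map_mul, map_sub, map_mul, hs₂, hb₂, map_one]
    exact (h₂ w).2.1

end Shift

end GlobalField

theorem mainTheorem6 {F E : Type*} [Field F] [Field E] [Algebra F E]
    (hF : GlobalField.IsGlobalField F)
    [Algebra.IsQuadraticExtension F E] [Algebra.IsSeparable F E]
    (α : E ≃ₐ[F] E) (hα : α ≠ 1) (n : ℕ) (hn : 1 ≤ n) :
    letI : StarRing (GlobalField.AdeleRing E) := GlobalField.adeleStarRing α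
    IsStarEuclidean (Matrix (Fin n) (Fin n) (GlobalField.AdeleRing E)) ∧
      IsStarEuclideanLength (Matrix (Fin n) (Fin n) (GlobalField.AdeleRing E)) 1 := by
  let : StarRing (GlobalField.AdeleRing E) := GlobalField.adeleStarRing α
  have key (a c : Matrix (Fin n) (Fin n) (GlobalField.AdeleRing E)) (h : IsStarCoprime a c) :
      HasStarDecomposition a c 1 := by
    obtain ⟨hac, hs⟩ := h
    obtain ⟨x, hx, y, hy, hxy⟩ := Submodule.mem_sup.1 (hac ▸ Submodule.mem_top (x := 1))
    obtain ⟨u, rfl⟩ := Ideal.mem_span_singleton'.1 hx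
    obtain ⟨v, rfl⟩ := Ideal.mem_span_singleton'.1 hy
    rw [IsSelfAdjoint, star_mul, star_star] at hs
    obtain ⟨s, b, hs, hb⟩ := GlobalField.exists_adele_shift α.toRingEquiv
      (GlobalField.quadratic_involutive α) hxy hs
    -- With the index shift, the terms `0, 1, 2` are `r₋₁, r₀, r₁`, and the last is the unit.
    refine ⟨fun k ↦ if k = 0 then a else if k = 1 then c else a - s * c, fun _ ↦ s, rfl, rfl,
      fun i hi ↦ ?_, ?_⟩
    · obtain rfl : i = 0 := by omega
      exact ⟨hs.symm, by simp⟩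
    · exact ⟨⟨_, b, hb, mul_eq_one_comm.1 hb⟩, rfl⟩
  refine ⟨fun a c h ↦ ⟨1, key a c h⟩, key, fun k hk ↦ ?_⟩
  by_contra hk0
  obtain rfl : k = 0 := by omega
  -- Length `0` would require `c` itself to be a unit, which fails for `(1, 0)` over a nontrivial
  -- ring with `n ≥ 1`.
  obtain ⟨r, -, -, hr, -, hu⟩ := hk 1 0 ⟨by simp [Ideal.span_singleton_one], by
    rw [mul_zero]; exact IsSelfAdjoint.zero _⟩
  have := hF.nonempty_finitePlace E
  have : Nontrivial (GlobalField.AdeleRing E) := GlobalField.nontrivial_adeleRing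
  have : Nonempty (Fin n) := ⟨⟨0, hn⟩⟩
  rw [zero_add, hr] at hu
  exact not_isUnit_zero hu
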